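/- Let $H$ be a real Hilbert space, let $f:H\to H$ be a $k$-contraction (Lipschitz with constant $k<1$), let $h:H\to\mathbb{R}$ be differentiable and convex with $\nabla h$ $\eta$-inverse strongly monotone for some $\eta>0$, i.e. $\langle \nabla h(x)-\nabla h(y),x-y\rangle\ge \eta\|\nabla h(x)-\nabla h(y)\|^2$ for all $x,y\in H$, and let $g:H\to(-\infty,\infty]$ be proper, convex and lower semicontinuous. Assume that the set $\Pi$ of minimizers of $h+g$ over $H$ is nonempty. Let $\lambda\in(0,2\eta)$ and $\lambda_n\in(0,2\eta)$ $(n\ge1)$ with $\lambda_n\to\lambda$, and put $$T_n=J^{\partial g}_{\lambda_n}(I-\lambda_n\nabla h),\qquad J^{\partial g}_{\lambda_n}=(I+\lambda_n\partial g)^{-1},$$ where $\partial g$ is the subdifferential of $g$. Let $\theta\ge 0$, and for $n\ge1$ let $\eta_n\in(0,\infty)$ and $\alpha_n,\beta_n,\gamma_n\in(0,1)$ be such that 1. $0<a\le\alpha_n<a'<1$ for all $n\ge1$, for some constants $a,a'$; 2. $\lim_{n\to\infty}\eta_n=0$; 3. $\lim_{n\to\infty}\gamma_n=0$ and $\sum_{n=1}^\infty\gamma_n=\infty$.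 Let $x_0,x_1\in H$ be arbitrary and let $\{x_n\}$ be generated, for $n\ge1$, by $$\begin{aligned} z_n&=x_n+\theta_n(x_n-x_{n-1}),\\ y_n&=(1-\beta_n)z_n+\beta_nT_nz_n,\\ \omega_n&=T_n\big((1-\alpha_n)T_nx_n+\alpha_nT_ny_n\big),\\ x_{n+1}&=(1-\gamma_n)T_n\omega_n+\gamma_nf(\omega_n), \end{aligned}$$ where $\theta_n=\min\{\theta,\ \eta_n\gamma_n/\|x_n-x_{n-1}\|\}$ if $x_n\ne x_{n-1}$, and $\theta_n=\theta$ otherwise. Then $\{x_n\}$ converges strongly to a point $x^*\in\Pi$ satisfying $x^*=P_\Pi f(x^*)$, where $P_\Pi$ is the metric projection of $H$ onto $\Pi$. -/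

import Mathlib

open Filter Topology

noncomputable section

namespace ProxGrad

variable {H : Type*} [NormedAddCommGroup H] [InnerProductSpace ℝ H]

/-- An extended-real-valued function is proper: it never takes the value `-∞`, and it is not
identically `+∞`. -/
def IsProper (g : H → EReal) : Prop :=
  (∀ x, g x ≠ ⊥) ∧ ∃ x, g x ≠ ⊤

/-- Convexity of an extended-real-valued function (used for functions that never take the value
`-∞`; recall that `0 * ⊤ = 0` in `EReal`). -/
def IsConvex (g : H → EReal) : Prop :=
  ∀ x y : H, ∀ a b : ℝ, 0 ≤ a → 0 ≤ b → a + b = 1 →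
    g (a • x + b • y) ≤ (a : EReal) * g x + (b : EReal) * g y

/-- `A : H → H` is `η`-inverse strongly monotone (`η > 0`). -/
def InverseStronglyMonotone (η : ℝ) (A : H → H) : Prop :=
  0 < η ∧ ∀ x y : H, η * ‖A x - A y‖ ^ 2 ≤ inner ℝ (A x - A y) (x - y)

/-- The subdifferential `∂g`, as a set-valued operator on `H`. -/
def subdifferential (g : H → EReal) : H → Set H :=
  fun x => {u | ∀ y : H, g x + ((inner ℝ u (y - x) : ℝ) : EReal) ≤ g y}

/-- The set-valued operator `(I + lam A)⁻¹`: the points `p` with `x ∈ p + lam A p`. -/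
def resolventSet (A : H → Set H) (lam : ℝ) (x : H) : Set H :=
  {p | ∃ u ∈ A p, x = p + lam • u}

/-- The resolvent `J_lam^A = (I + lam A)⁻¹` as a map `H → H`: the point of `resolventSet A lam x`,
which exists and is unique when `A` is maximal monotone and `lam > 0`. -/
def resolvent (A : H → Set H) (lam : ℝ) (x : H) : H :=
  Classical.epsilon fun p => p ∈ resolventSet A lam x

/-- The proximal-gradient map `J_lam^{∂g} (I - lam ∇h)`. -/
def proxGradMap [CompleteSpace H] (h : H → ℝ) (g : H → EReal) (lam : ℝ) (x : H) : H :=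
  resolvent (subdifferential g) lam (x - lam • gradient h x)

/-- The set of (global) minimizers of `h + g`. -/
def minimizers (h : H → ℝ) (g : H → EReal) : Set H :=
  {x | ∀ y : H, (h x : EReal) + g x ≤ (h y : EReal) + g y}

/-- `p = P_C u`: the point `p` is the unique point of `C` nearest to `u`. -/
def IsMetricProjection (C : Set H) (u p : H) : Prop :=
  p ∈ C ∧ ∀ y ∈ C, y ≠ p → ‖u - p‖ < ‖u - y‖

open Classical in
/-- The inertial parameter: `min {θ, c / ‖v - w‖}` if `v ≠ w`, and `θ` otherwise. -/
def inertialParam (θ c : ℝ) (v w : H) : ℝ :=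
  if v ≠ w then min θ (c / ‖v - w‖) else θ

end ProxGrad

end

/-!
The proof compares the iterates with the point `p` of the set `Π` of minimizers of `h + g` that
satisfies `p = P_Π (f p)`. It exists because `P_Π ∘ f` is a contraction
(`exists_fixedPoint_projection`), and it is characterized by `⟪f p - p, w - p⟫ ≤ 0` for `w ∈ Π`.

The proximal-gradient map `T` is defined everywhere (`resolvent_mem`), and for `lam < 2 η` its
displacement is controlled by the gain in distance,
`(2 η - lam) ‖x - T x‖² ≤ 2 η (‖x - p‖² - ‖T x - p‖²)` (`norm_sub_proxGradMap_sq_le`). In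
particular no inner step increases the distance to `p`, except for the inertial term, which costs at
most `e n * γ n`. With `v n = T_n (ω n)` this gives boundedness of the iterates and, for
`s n = ‖x n - p‖²`,

  `s (n + 1) ≤ (1 - (1 - k) γ n) s n - (1 - γ n) (‖ω n - p‖² - ‖v n - p‖²) + γ n c n`,

where `c n` is `2 ⟪f p - p, x (n + 1) - p⟫` plus a null sequence. Such an inequality forces
`s n → 0` as soon as `c n` is small whenever the gain `‖ω n - p‖² - ‖v n - p‖²` is
(`tendsto_zero_of_recursive_le`).

If the gain is small, then so is `‖ω n - v n‖`, and the subgradient inequality at `v n` shows that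
`v n` nearly minimizes `h + g` (`proxGradMap_mem_sublevel`). Near-minimizers of bounded norm nearly
satisfy the variational inequality of `p` (`exists_sublevel_inner_le`), and `x (n + 1) - v n → 0`, so
`c n` is small. This replaces weak subsequential limits and demiclosedness. The compactness behind
it, and behind the existence of the resolvent, is that decreasing bounded nonempty closed convex sets
of a Hilbert space have a common point (`nonempty_iInter_of_antitone_convex`).
-/

namespace ProxGrad

variable {H : Type*} [NormedAddCommGroup H] [InnerProductSpace ℝ H]

/-! ### Convex sets in Hilbert space -/

/-- The variational characterization of the point of a closed convex set nearest to `u`. -/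
theorem exists_inner_sub_le_zero [CompleteSpace H] {C : Set H} (hne : C.Nonempty)
    (hcl : IsClosed C) (hcv : Convex ℝ C) (u : H) :
    ∃ p ∈ C, ∀ w ∈ C, inner ℝ (u - p) (w - p) ≤ 0 := by
  obtain ⟨p, hp, h⟩ := exists_norm_eq_iInf_of_complete_convex hne hcl.isComplete hcv u
  exact ⟨p, hp, (norm_eq_iInf_iff_real_inner_le_zero hcv hp).1 h⟩

/-- Bounded closed convex sets in a Hilbert space satisfy the nested intersection property, usually
a consequence of weak compactness. Here the points of least norm form a Cauchy sequence, whose limit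
lies in every set. -/
theorem nonempty_iInter_of_antitone_convex [CompleteSpace H] {C : ℕ → Set H}
    (hanti : Antitone C) (hne : ∀ n, (C n).Nonempty) (hcl : ∀ n, IsClosed (C n))
    (hcv : ∀ n, Convex ℝ (C n)) {R : ℝ} (hbd : ∀ v ∈ C 0, ‖v‖ ≤ R) :
    (⋂ n, C n).Nonempty := by
  choose q hqC hq using fun n => exists_inner_sub_le_zero (hne n) (hcl n) (hcv n) 0
  have hsq : ∀ m n, m ≤ n → ‖q n - q m‖ ^ 2 ≤ ‖q n‖ ^ 2 - ‖q m‖ ^ 2 := by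
    intro m n hmn
    have h1 := hq m (q n) (hanti hmn (hqC n))
    have h2 : ‖q n‖ ^ 2 = ‖q m + (q n - q m)‖ ^ 2 := by congr 2; abel
    rw [norm_add_sq_real] at h2
    rw [zero_sub, inner_neg_left] at h1
    linarith
  have hmono : Monotone fun n => ‖q n‖ ^ 2 := fun m n hmn => by
    have := hsq m n hmn
    have := sq_nonneg ‖q n - q m‖
    show ‖q m‖ ^ 2 ≤ ‖q n‖ ^ 2
    linarith
  have hbdd : BddAbove (Set.range fun n => ‖q n‖ ^ 2) := by
    refine ⟨R ^ 2, ?_⟩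
    rintro _ ⟨n, rfl⟩
    exact pow_le_pow_left₀ (norm_nonneg _) (hbd _ (hanti (Nat.zero_le n) (hqC n))) 2
  have hlim := tendsto_atTop_ciSup hmono hbdd
  have hcau : CauchySeq q := by
    rw [Metric.cauchySeq_iff']
    intro ε hε
    obtain ⟨N, hN⟩ := Metric.cauchySeq_iff'.1 hlim.cauchySeq (ε ^ 2) (by positivity)
    refine ⟨N, fun n hn => ?_⟩
    have h1 := hN n hn
    rw [Real.dist_eq] at h1
    rw [dist_eq_norm]
    exact lt_of_pow_lt_pow_left₀ 2 hε.le
      ((hsq N n hn).trans_lt ((le_abs_self _).trans_lt h1))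
  obtain ⟨b, hb⟩ := cauchySeq_tendsto_of_complete hcau
  refine ⟨b, Set.mem_iInter.2 fun n => (hcl n).mem_of_tendsto hb ?_⟩
  filter_upwards [eventually_ge_atTop n] with m hm using hanti hm (hqC m)

theorem isMetricProjection_of_inner_le_zero {C : Set H} {u p : H} (hp : p ∈ C)
    (h : ∀ w ∈ C, inner ℝ (u - p) (w - p) ≤ 0) : IsMetricProjection C u p := by
  refine ⟨hp, fun y hy hne => lt_of_pow_lt_pow_left₀ 2 (norm_nonneg _) ?_⟩
  have h1 := norm_sub_sq_real (u - p) (y - p)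
  rw [sub_sub_sub_cancel_right] at h1
  have h2 : 0 < ‖y - p‖ := norm_pos_iff.2 (sub_ne_zero.2 hne)
  nlinarith [h y hy]

/-- The metric projection onto a closed convex set composed with a contraction is a contraction,
so it has a fixed point, here described by its variational inequality. -/
theorem exists_fixedPoint_projection [CompleteSpace H] {C : Set H} (hne : C.Nonempty)
    (hcl : IsClosed C) (hcv : Convex ℝ C) {f : H → H} {k : NNReal} (hf : ContractingWith k f) :
    ∃ p ∈ C, ∀ w ∈ C, inner ℝ (f p - p) (w - p) ≤ 0 := by
  choose P hPC hP using exists_inner_sub_le_zero hne hcl hcv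
  have hlip : LipschitzWith 1 P := by
    refine LipschitzWith.of_dist_le_mul fun u v => ?_
    rw [dist_eq_norm, dist_eq_norm, NNReal.coe_one, one_mul]
    have h1 := hP u (P v) (hPC v)
    have h2 := hP v (P u) (hPC u)
    have h3 : inner ℝ (u - P u) (P v - P u) + inner ℝ (v - P v) (P u - P v)
        = ‖P u - P v‖ ^ 2 - inner ℝ (u - v) (P u - P v) := by
      rw [← real_inner_self_eq_norm_sq]
      simp only [inner_sub_left, inner_sub_right]
      rw [real_inner_comm (P v) (P u)]
      ring
    have h4 := real_inner_le_norm (u - v) (P u - P v)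
    rcases (norm_nonneg (P u - P v)).eq_or_lt with h0 | h0
    · rw [← h0]; exact norm_nonneg _
    · nlinarith
  have hc : ContractingWith k (P ∘ f) :=
    ⟨hf.1, by simpa using hlip.comp hf.2⟩
  have : Nonempty H := ⟨hne.some⟩
  have hfix : P (f (hc.fixedPoint)) = hc.fixedPoint := hc.fixedPoint_isFixedPt
  refine ⟨hc.fixedPoint, hfix ▸ hPC _, fun w hw => ?_⟩
  have := hP (f hc.fixedPoint) w hw
  rwa [hfix] at this

/-! ### Extended-real-valued convex functions -/

theorem IsProper.exists_coe {X : Type*} {g : X → EReal} (hg : IsProper g) {x : X} (hx : g x ≠ ⊤) :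
    ∃ r : ℝ, g x = r := ⟨(g x).toReal, (EReal.coe_toReal hx (hg.1 x)).symm⟩

theorem IsProper.exists_coe_of_le {X : Type*} {g : X → EReal} (hg : IsProper g) {x : X} {c : ℝ}
    (hx : g x ≤ c) : ∃ r : ℝ, g x = r ∧ r ≤ c := by
  obtain ⟨r, hr⟩ := hg.exists_coe (ne_top_of_le_ne_top (EReal.coe_ne_top c) hx)
  exact ⟨r, hr, by rw [hr] at hx; exact_mod_cast hx⟩

theorem IsConvex.le_coe {g : H → EReal} (hg : IsConvex g) {x y : H} {r s a b : ℝ}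
    (hx : g x = r) (hy : g y = s) (ha : 0 ≤ a) (hb : 0 ≤ b) (hab : a + b = 1) :
    g (a • x + b • y) ≤ ((a * r + b * s : ℝ) : EReal) := by
  have := hg x y a b ha hb hab
  rw [hx, hy] at this
  exact_mod_cast this

theorem mem_minimizers_iff {X : Type*} {h : X → ℝ} {g : X → EReal} (hg : IsProper g) {p : X} :
    p ∈ minimizers h g ↔
      ∃ r : ℝ, g p = r ∧ ∀ (y : X) (s : ℝ), g y = s → h p + r ≤ h y + s := by
  constructor
  · intro hp
    have hp' : ∀ y, (h p : EReal) + g p ≤ (h y : EReal) + g y := hp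
    obtain ⟨y₀, hy₀⟩ := hg.2
    obtain ⟨s₀, hs₀⟩ := hg.exists_coe hy₀
    have hfin : g p ≠ ⊤ := by
      intro htop
      have := hp' y₀
      rw [htop, hs₀, EReal.coe_add_top, top_le_iff, ← EReal.coe_add] at this
      exact EReal.coe_ne_top _ this
    obtain ⟨r, hr⟩ := hg.exists_coe hfin
    refine ⟨r, hr, fun y s hs => ?_⟩
    have := hp' y
    rw [hr, hs] at this
    exact_mod_cast this
  · rintro ⟨r, hr, hmin⟩ y
    rcases eq_or_ne (g y) ⊤ with htop | hfin
    · rw [htop, EReal.coe_add_top]; exact le_top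
    · obtain ⟨s, hs⟩ := hg.exists_coe hfin
      rw [hr, hs]
      exact_mod_cast hmin y s hs

theorem mem_subdifferential_iff {g : H → EReal} (hg : IsProper g) {p u : H} :
    u ∈ subdifferential g p ↔
      ∃ r : ℝ, g p = r ∧ ∀ (y : H) (s : ℝ), g y = s → r + inner ℝ u (y - p) ≤ s := by
  constructor
  · intro hu
    have hu' : ∀ y, g p + ((inner ℝ u (y - p) : ℝ) : EReal) ≤ g y := hu
    obtain ⟨y₀, hy₀⟩ := hg.2
    have hfin : g p ≠ ⊤ := by
      intro htop
      have := hu' y₀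
      rw [htop, EReal.top_add_coe, top_le_iff] at this
      exact hy₀ this
    obtain ⟨r, hr⟩ := hg.exists_coe hfin
    refine ⟨r, hr, fun y s hs => ?_⟩
    have := hu' y
    rw [hr, hs] at this
    exact_mod_cast this
  · rintro ⟨r, hr, hmin⟩ y
    rcases eq_or_ne (g y) ⊤ with htop | hfin
    · rw [htop]; exact le_top
    · obtain ⟨s, hs⟩ := hg.exists_coe hfin
      rw [hr, hs]
      exact_mod_cast hmin y s hs

/-- The sublevel set `{φ + g ≤ c}`, with the real-valued function moved to the right-hand side so
that no extended-real addition is involved. -/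
def sublevel {X : Type*} (φ : X → ℝ) (g : X → EReal) (c : ℝ) : Set X :=
  {v | g v ≤ ((c - φ v : ℝ) : EReal)}

theorem sublevel_mono {X : Type*} {φ : X → ℝ} {g : X → EReal} : Monotone (sublevel φ g) := by
  intro c d hcd v hv
  refine le_trans (show g v ≤ _ from hv) ?_
  exact_mod_cast sub_le_sub_right hcd _

theorem isClosed_sublevel {X : Type*} [TopologicalSpace X] {φ : X → ℝ} {g : X → EReal}
    (hφ : Continuous φ)
    (hg : LowerSemicontinuous g) (c : ℝ) : IsClosed (sublevel φ g c) := by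
  have hc : Continuous fun v => (v, ((c - φ v : ℝ) : EReal)) :=
    continuous_id.prodMk (continuous_coe_real_ereal.comp (continuous_const.sub hφ))
  exact hg.isClosed_epigraph.preimage hc

theorem convex_sublevel {φ : H → ℝ} {g : H → EReal} (hφ : ConvexOn ℝ Set.univ φ)
    (hg : IsProper g) (hgc : IsConvex g) (c : ℝ) : Convex ℝ (sublevel φ g c) := by
  intro v hv w hw a b ha hb hab
  obtain ⟨r, hr, hrc⟩ := hg.exists_coe_of_le hv
  obtain ⟨s, hs, hsc⟩ := hg.exists_coe_of_le hw
  refine (hgc.le_coe hr hs ha hb hab).trans ?_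
  have := hφ.2 (Set.mem_univ v) (Set.mem_univ w) ha hb hab
  rw [smul_eq_mul, smul_eq_mul] at this
  have h1 := mul_le_mul_of_nonneg_left hrc ha
  have h2 := mul_le_mul_of_nonneg_left hsc hb
  have h3 : a * c + b * c = c := by rw [← add_mul, hab, one_mul]
  exact_mod_cast (by linarith : a * r + b * s ≤ c - φ (a • v + b • w))

theorem minimizers_eq_sublevel {X : Type*} {h : X → ℝ} {g : X → EReal} (hg : IsProper g)
    {p : X} {r : ℝ} (hp : p ∈ minimizers h g) (hr : g p = r) :
    minimizers h g = sublevel h g (h p + r) := by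
  obtain ⟨r', hr', hmin⟩ := (mem_minimizers_iff hg).1 hp
  obtain rfl : r' = r := by rw [hr] at hr'; exact_mod_cast hr'.symm
  ext v
  rw [mem_minimizers_iff hg]
  constructor
  · rintro ⟨s, hs, hv⟩
    have := hv p r' hr
    show g v ≤ _
    rw [hs]
    exact_mod_cast (by linarith : s ≤ h p + r' - h v)
  · intro hv
    obtain ⟨s, hs, hsc⟩ := hg.exists_coe_of_le hv
    exact ⟨s, hs, fun y t ht => by linarith [hmin y t ht]⟩

/-- A convex lower semicontinuous function minorized by a positive multiple of the squared
distance to a point, up to a constant, attains its minimum. -/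
theorem minimizers_nonempty_of_coercive [CompleteSpace H] {φ : H → ℝ} {g : H → EReal}
    (hφ : Continuous φ) (hφc : ConvexOn ℝ Set.univ φ) (hg : IsProper g) (hgc : IsConvex g)
    (hgl : LowerSemicontinuous g) {c K : ℝ} (hc : 0 < c) (x : H)
    (hco : ∀ (y : H) (s : ℝ), g y = s → c * ‖y - x‖ ^ 2 - K ≤ φ y + s) :
    (minimizers φ g).Nonempty := by
  set S : Set ℝ := {t | ∃ (y : H) (s : ℝ), g y = s ∧ φ y + s = t} with hS
  have hbelow : BddBelow S := by
    refine ⟨-K, ?_⟩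
    rintro _ ⟨y, s, hs, rfl⟩
    have := hco y s hs
    have : 0 ≤ c * ‖y - x‖ ^ 2 := by positivity
    linarith
  have hSne : S.Nonempty := by
    obtain ⟨y, hy⟩ := hg.2
    obtain ⟨s, hs⟩ := hg.exists_coe hy
    exact ⟨_, y, s, hs, rfl⟩
  set m := sInf S
  have hpos : ∀ n : ℕ, (0 : ℝ) < 1 / ((n : ℝ) + 1) := fun n => Nat.one_div_pos_of_nat
  obtain ⟨q, hq⟩ := nonempty_iInter_of_antitone_convex
    (C := fun n : ℕ => sublevel φ g (m + 1 / ((n : ℝ) + 1)))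
    (fun i j hij => sublevel_mono (by
      have := Nat.one_div_le_one_div (α := ℝ) hij; linarith))
    (fun n => by
      obtain ⟨_, ⟨y, s, hs, rfl⟩, hlt⟩ :=
        exists_lt_of_csInf_lt hSne (lt_add_of_pos_right m (hpos n))
      refine ⟨y, ?_⟩
      show g y ≤ _
      rw [hs]
      exact_mod_cast (by linarith : s ≤ m + 1 / ((n : ℝ) + 1) - φ y))
    (fun n => isClosed_sublevel hφ hgl _) (fun n => convex_sublevel hφc hg hgc _)
    (R := ‖x‖ + ((K + m + 1) / c + 1)) (fun v hv => by
      obtain ⟨s, hs, hsc⟩ := hg.exists_coe_of_le hv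
      have h1 := hco v s hs
      norm_num at hsc
      have h2 : ‖v - x‖ ^ 2 ≤ (K + m + 1) / c := by
        rw [le_div_iff₀ hc]; linarith
      have h3 : ‖v‖ ≤ ‖x‖ + ‖v - x‖ := by
        simpa using norm_add_le x (v - x)
      nlinarith [sq_nonneg (‖v - x‖ - 1)])
  rw [Set.mem_iInter] at hq
  obtain ⟨r, hr, -⟩ := hg.exists_coe_of_le (hq 0)
  refine ⟨q, (mem_minimizers_iff hg).2 ⟨r, hr, fun y s hs => ?_⟩⟩
  refine (le_of_forall_pos_le_add fun ε hε => ?_).trans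
    (csInf_le hbelow ⟨y, s, hs, rfl⟩ : m ≤ φ y + s)
  obtain ⟨n, hn⟩ := exists_nat_one_div_lt hε
  have := hq n
  rw [sublevel, Set.mem_ofPred_eq, hr, EReal.coe_le_coe_iff] at this
  linarith

/-- A proper convex lower semicontinuous function is bounded below by a radially affine function.
Lower semicontinuity bounds `g` below on a ball around a point of its domain, and convexity
propagates the bound along rays. -/
theorem exists_radial_minorant {g : H → EReal} (hg : IsProper g) (hgc : IsConvex g)
    (hgl : LowerSemicontinuous g) (x : H) :
    ∃ A B : ℝ, 0 ≤ B ∧ ∀ (y : H) (s : ℝ), g y = s → A - B * ‖y - x‖ ≤ s := by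
  obtain ⟨w, hw⟩ := hg.2
  obtain ⟨r, hr⟩ := hg.exists_coe hw
  have hev : ∀ᶠ v in 𝓝 w, ((r - 1 : ℝ) : EReal) < g v := by
    refine hgl w _ (show _ < g w from ?_)
    rw [hr]
    exact_mod_cast sub_one_lt r
  obtain ⟨δ, hδ, hball⟩ := Metric.eventually_nhds_iff.1 hev
  have hδ2 : 0 < δ / 2 := by positivity
  have key : ∀ (y : H) (s : ℝ), g y = s → r - 1 - (2 / δ) * ‖y - w‖ ≤ s := by
    intro y s hs
    rcases lt_or_ge ‖y - w‖ δ with hlt | hge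
    · have h1 := hball (y := y) (by rwa [dist_eq_norm])
      rw [hs, EReal.coe_lt_coe_iff] at h1
      have : 0 ≤ 2 / δ * ‖y - w‖ := by positivity
      linarith
    · have hN : 0 < ‖y - w‖ := hδ.trans_le hge
      set t := δ / 2 / ‖y - w‖ with ht
      have ht0 : 0 < t := by positivity
      have ht1 : t ≤ 1 := by rw [ht, div_le_one hN]; linarith
      have h1 := hgc.le_coe hr hs (sub_nonneg.2 ht1) ht0.le (by ring)
      have hd : dist ((1 - t) • w + t • y) w < δ := by
        have : (1 - t) • w + t • y - w = t • (y - w) := by module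
        rw [dist_eq_norm, this, norm_smul, Real.norm_of_nonneg ht0.le, ht,
          div_mul_cancel₀ _ hN.ne']
        linarith
      have h2 := (hball hd).trans_le h1
      rw [EReal.coe_lt_coe_iff] at h2
      have h3 : t * (2 / δ * ‖y - w‖) = 1 := by
        rw [ht]; field_simp
      have h4 : t * (r - 1 - 2 / δ * ‖y - w‖) ≤ t * s := by
        rw [mul_sub, h3]; nlinarith
      exact le_of_mul_le_mul_left h4 ht0
  refine ⟨r - 1 - 2 / δ * ‖x - w‖, 2 / δ, by positivity, fun y s hs => ?_⟩
  have h1 := key y s hs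
  have h2 : ‖y - w‖ ≤ ‖y - x‖ + ‖x - w‖ := norm_sub_le_norm_sub_add_norm_sub y x w
  have h3 : 2 / δ * ‖y - w‖ ≤ 2 / δ * (‖y - x‖ + ‖x - w‖) := by gcongr
  linarith

/-! ### First-order conditions and the resolvent of a subdifferential -/

theorem tendsto_slope_line [CompleteSpace H] {φ : H → ℝ} {φ' p : H} (hφ : HasGradientAt φ φ' p)
    (d : H) :
    Tendsto (fun t : ℝ => t⁻¹ * (φ (p + t • d) - φ p)) (𝓝[>] 0) (𝓝 (inner ℝ φ' d)) := by
  have h1 := (hasGradientAt_iff_hasFDerivAt.1 hφ).hasLineDerivAt d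
  have h2 : HasDerivAt (fun t : ℝ => φ (p + t • d)) (inner ℝ φ' d) 0 := h1
  simpa using h2.tendsto_slope_zero_right

theorem gradient_inequality [CompleteSpace H] {h : H → ℝ} (hc : ConvexOn ℝ Set.univ h)
    {h' p : H} (hd : HasGradientAt h h' p) (y : H) : h p + inner ℝ h' (y - p) ≤ h y := by
  have : inner ℝ h' (y - p) ≤ h y - h p := by
    refine le_of_tendsto (tendsto_slope_line hd (y - p)) ?_
    filter_upwards [Ioo_mem_nhdsGT (zero_lt_one' ℝ)] with t ht
    have h1 := hc.2 (Set.mem_univ p) (Set.mem_univ y) (sub_nonneg.2 ht.2.le) ht.1.le (by ring)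
    have h2 : p + t • (y - p) = (1 - t) • p + t • y := by module
    rw [inv_mul_le_iff₀ ht.1, h2]
    rw [smul_eq_mul, smul_eq_mul] at h1
    linarith
  linarith

/-- Fermat's rule for the sum of a differentiable function and a convex one. -/
theorem neg_gradient_mem_subdifferential [CompleteSpace H] {φ : H → ℝ} {g : H → EReal}
    (hg : IsProper g) (hgc : IsConvex g) {φ' p : H} (hφ : HasGradientAt φ φ' p)
    (hp : p ∈ minimizers φ g) : -φ' ∈ subdifferential g p := by
  obtain ⟨r, hr, hmin⟩ := (mem_minimizers_iff hg).1 hp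
  refine (mem_subdifferential_iff hg).2 ⟨r, hr, fun y s hs => ?_⟩
  have : r - s ≤ inner ℝ φ' (y - p) := by
    refine ge_of_tendsto (tendsto_slope_line hφ (y - p)) ?_
    filter_upwards [Ioo_mem_nhdsGT (zero_lt_one' ℝ)] with t ht
    have h2 : p + t • (y - p) = (1 - t) • p + t • y := by module
    obtain ⟨q, hq, hqs⟩ := hg.exists_coe_of_le
      (hgc.le_coe hr hs (sub_nonneg.2 ht.2.le) ht.1.le (by ring))
    have h1 := hmin _ q hq
    rw [le_inv_mul_iff₀ ht.1, h2]
    linarith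
  rw [inner_neg_left]
  linarith

theorem hasGradientAt_norm_sub_sq [CompleteSpace H] (c : ℝ) (x p : H) :
    HasGradientAt (fun y => (2 * c)⁻¹ * ‖y - x‖ ^ 2) (c⁻¹ • (p - x)) p := by
  rw [hasGradientAt_iff_hasFDerivAt]
  have h := (((hasFDerivAt_id p).sub_const x).norm_sq).const_mul ((2 * c)⁻¹)
  refine h.congr_fderiv ?_
  ext v
  simp
  ring

/-- For a proper convex lower semicontinuous `g`, the resolvent of `∂g` is everywhere defined: its
value at `x` is produced by minimizing `‖· - x‖² / (2 lam) + g`. -/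
theorem resolvent_mem [CompleteSpace H] {g : H → EReal} (hg : IsProper g) (hgc : IsConvex g)
    (hgl : LowerSemicontinuous g) {lam : ℝ} (hlam : 0 < lam) (x : H) :
    resolvent (subdifferential g) lam x ∈ resolventSet (subdifferential g) lam x := by
  refine Classical.epsilon_spec (p := fun p => p ∈ resolventSet (subdifferential g) lam x) ?_
  obtain ⟨A, B, hB, hAB⟩ := exists_radial_minorant hg hgc hgl x
  have hconv : ConvexOn ℝ Set.univ fun y : H => (2 * lam)⁻¹ * ‖y - x‖ ^ 2 := by
    have h1 : ConvexOn ℝ Set.univ fun y : H => ‖y - x‖ ^ 2 := by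
      have h2 := (convexOn_univ_dist x).pow (fun y _ => dist_nonneg) 2
      simpa only [dist_eq_norm, Pi.pow_def] using h2
    exact h1.smul (c := (2 * lam)⁻¹) (by positivity)
  obtain ⟨p, hp⟩ := minimizers_nonempty_of_coercive (φ := fun y => (2 * lam)⁻¹ * ‖y - x‖ ^ 2)
    (c := (4 * lam)⁻¹) (K := lam * B ^ 2 - A) (by fun_prop) hconv hg hgc hgl (by positivity) x
    (fun y s hs => by
      have h1 := hAB y s hs
      have h2 : 0 ≤ (4 * lam)⁻¹ * (‖y - x‖ - 2 * lam * B) ^ 2 := by positivity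
      have h3 : (4 * lam)⁻¹ * (‖y - x‖ - 2 * lam * B) ^ 2
          = (2 * lam)⁻¹ * ‖y - x‖ ^ 2 - (4 * lam)⁻¹ * ‖y - x‖ ^ 2 - B * ‖y - x‖
            + lam * B ^ 2 := by
        field_simp
        ring
      linarith)
  refine ⟨p, _, neg_gradient_mem_subdifferential hg hgc (hasGradientAt_norm_sub_sq lam x p) hp, ?_⟩
  rw [smul_neg, smul_inv_smul₀ hlam.ne']
  abel

theorem inner_sub_nonneg_of_mem_subdifferential {g : H → EReal} (hg : IsProper g) {p q u v : H}
    (hu : u ∈ subdifferential g p) (hv : v ∈ subdifferential g q) :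
    0 ≤ inner ℝ (u - v) (p - q) := by
  obtain ⟨r, hr, h1⟩ := (mem_subdifferential_iff hg).1 hu
  obtain ⟨s, hs, h2⟩ := (mem_subdifferential_iff hg).1 hv
  have h3 := h1 q s hs
  have h4 := h2 p r hr
  rw [← neg_sub p q, inner_neg_right] at h3
  rw [inner_sub_left]
  linarith

/-! ### The proximal-gradient map -/

/-- The subgradient of `g` that the proximal-gradient map selects. -/
theorem sub_gradient_mem_subdifferential [CompleteSpace H] {h : H → ℝ} {g : H → EReal}
    (hg : IsProper g) (hgc : IsConvex g) (hgl : LowerSemicontinuous g) {lam : ℝ} (hlam : 0 < lam)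
    (x : H) :
    lam⁻¹ • (x - proxGradMap h g lam x) - gradient h x ∈
      subdifferential g (proxGradMap h g lam x) := by
  obtain ⟨u, hu, hxu⟩ := resolvent_mem hg hgc hgl hlam (x - lam • gradient h x)
  change x - lam • gradient h x = proxGradMap h g lam x + lam • u at hxu
  have : u = lam⁻¹ • (x - proxGradMap h g lam x) - gradient h x := by
    have h1 : x - proxGradMap h g lam x = lam • (u + gradient h x) := by
      rw [smul_add, ← sub_eq_zero, ← sub_eq_zero.2 hxu]; abel
    rw [h1, inv_smul_smul₀ hlam.ne', add_sub_cancel_right]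
  exact this ▸ hu

/-- The proximal-gradient map is strongly quasi-nonexpansive with respect to the minimizers: a
displacement of `x` is paid for by a decrease of the distance to every minimizer. -/
theorem norm_sub_proxGradMap_sq_le [CompleteSpace H] {h : H → ℝ} (hd : Differentiable ℝ h)
    {η : ℝ} (hism : InverseStronglyMonotone η (gradient h)) {g : H → EReal}
    (hg : IsProper g) (hgc : IsConvex g) (hgl : LowerSemicontinuous g) {lam : ℝ} (hlam : 0 < lam)
    {p : H} (hp : p ∈ minimizers h g) (x : H) :
    (2 * η - lam) * ‖x - proxGradMap h g lam x‖ ^ 2 ≤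
      2 * η * (‖x - p‖ ^ 2 - ‖proxGradMap h g lam x - p‖ ^ 2) := by
  have hη := hism.1
  have hsub := sub_gradient_mem_subdifferential (h := h) hg hgc hgl hlam x
  have hmon := inner_sub_nonneg_of_mem_subdifferential hg hsub
    (neg_gradient_mem_subdifferential hg hgc (hd p).hasGradientAt hp)
  have hco := hism.2 x p
  set v := proxGradMap h g lam x
  set A := gradient h x - gradient h p with hA
  set w := x - v with hw
  have e1 : lam⁻¹ • w - gradient h x - -gradient h p = lam⁻¹ • (w - lam • A) := by
    rw [smul_sub _ w, inv_smul_smul₀ hlam.ne', hA]; abel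
  rw [e1, inner_smul_left, conj_trivial, inner_sub_left, inner_smul_left, conj_trivial] at hmon
  have hmon' : lam * inner ℝ A (v - p) ≤ inner ℝ w (v - p) :=
    sub_nonneg.1 (nonneg_of_mul_nonneg_right hmon (inv_pos.2 hlam))
  have e2 : x - p = w + (v - p) := by rw [hw]; abel
  have e3 : inner ℝ A (x - p) = inner ℝ A w + inner ℝ A (v - p) := by rw [e2, inner_add_right]
  have e4 : ‖x - p‖ ^ 2 = ‖w‖ ^ 2 + 2 * inner ℝ w (v - p) + ‖v - p‖ ^ 2 := by
    rw [e2, norm_add_sq_real]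
  have hcs := real_inner_le_norm A w
  -- Completing the square: `η ‖A‖² - ‖A‖ ‖w‖ ≥ -‖w‖² / (4 η)`.
  have h5 : -‖w‖ ^ 2 ≤ 4 * η * inner ℝ A (v - p) := by
    nlinarith [sq_nonneg (2 * η * ‖A‖ - ‖w‖)]
  nlinarith

theorem norm_proxGradMap_sub_le [CompleteSpace H] {h : H → ℝ} (hd : Differentiable ℝ h)
    {η : ℝ} (hism : InverseStronglyMonotone η (gradient h)) {g : H → EReal}
    (hg : IsProper g) (hgc : IsConvex g) (hgl : LowerSemicontinuous g) {lam : ℝ}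
    (hlam : lam ∈ Set.Ioo 0 (2 * η)) {p : H} (hp : p ∈ minimizers h g) (x : H) :
    ‖proxGradMap h g lam x - p‖ ≤ ‖x - p‖ := by
  have h1 := norm_sub_proxGradMap_sq_le hd hism hg hgc hgl hlam.1 hp x
  have h2 : 0 ≤ (2 * η - lam) * ‖x - proxGradMap h g lam x‖ ^ 2 :=
    mul_nonneg (sub_nonneg.2 hlam.2.le) (sq_nonneg _)
  have h3 := nonneg_of_mul_nonneg_right (h2.trans h1) (mul_pos two_pos hism.1)
  exact (sq_le_sq₀ (norm_nonneg _) (norm_nonneg _)).1 (sub_nonneg.1 h3)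

theorem InverseStronglyMonotone.norm_sub_le {η : ℝ} {A : H → H}
    (hA : InverseStronglyMonotone η A) (x y : H) : η * ‖A x - A y‖ ≤ ‖x - y‖ := by
  have h1 := (hA.2 x y).trans (real_inner_le_norm _ _)
  rcases (norm_nonneg (A x - A y)).eq_or_lt with h0 | h0
  · rw [← h0, mul_zero]; exact norm_nonneg _
  · refine le_of_mul_le_mul_left ?_ h0
    linarith

/-- The objective at `proxGradMap h g lam x` exceeds its minimum by at most a multiple of the
displacement of `x`. -/
theorem proxGradMap_mem_sublevel [CompleteSpace H] {h : H → ℝ} (hd : Differentiable ℝ h)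
    (hc : ConvexOn ℝ Set.univ h) {η : ℝ} (hism : InverseStronglyMonotone η (gradient h))
    {g : H → EReal} (hg : IsProper g) (hgc : IsConvex g) (hgl : LowerSemicontinuous g) {lam : ℝ}
    (hlam : 0 < lam) {p : H} {r : ℝ} (hr : g p = r) (x : H) :
    proxGradMap h g lam x ∈ sublevel h g (h p + r + (lam⁻¹ + η⁻¹) *
      ‖x - proxGradMap h g lam x‖ * ‖proxGradMap h g lam x - p‖) := by
  have hsub := sub_gradient_mem_subdifferential (h := h) hg hgc hgl hlam x
  set v := proxGradMap h g lam x
  obtain ⟨s, hs, hsg⟩ := (mem_subdifferential_iff hg).1 hsub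
  have h1 := hsg p r hr
  have h2 := gradient_inequality hc (hd v).hasGradientAt p
  have h3 : s + h v ≤ h p + r +
      inner ℝ (lam⁻¹ • (x - v) - (gradient h x - gradient h v)) (v - p) := by
    rw [← neg_sub v p, inner_neg_right] at h1 h2
    simp only [inner_sub_left (𝕜 := ℝ) _ _ (v - p)] at h1 ⊢
    linarith
  have h4 := real_inner_le_norm (lam⁻¹ • (x - v) - (gradient h x - gradient h v)) (v - p)
  have h5 : ‖lam⁻¹ • (x - v) - (gradient h x - gradient h v)‖ ≤ (lam⁻¹ + η⁻¹) * ‖x - v‖ := by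
    refine (norm_sub_le _ _).trans ?_
    rw [norm_smul, Real.norm_of_nonneg (inv_pos.2 hlam).le, add_mul]
    have := (le_inv_mul_iff₀ hism.1).2 (hism.norm_sub_le x v)
    linarith
  have h6 := mul_le_mul_of_nonneg_right h5 (norm_nonneg (v - p))
  show g v ≤ _
  rw [hs, EReal.coe_le_coe_iff]
  linarith

/-- Uniform form of the variational inequality at the projection `p` of `u` onto the minimizers:
it holds up to `ε` at points of bounded norm that are nearly minimizers. Otherwise the slices
`{F ≤ min F + δ} ∩ {‖· - p‖ ≤ R} ∩ {⟪u - p, · - p⟫ ≥ ε}` would have a point in common, which would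
be a minimizer violating the inequality. -/
theorem exists_sublevel_inner_le [CompleteSpace H] {h : H → ℝ} (hcont : Continuous h)
    (hc : ConvexOn ℝ Set.univ h) {g : H → EReal} (hg : IsProper g) (hgc : IsConvex g)
    (hgl : LowerSemicontinuous g) {p u : H} {r : ℝ} (hp : p ∈ minimizers h g) (hr : g p = r)
    (hu : ∀ w ∈ minimizers h g, inner ℝ (u - p) (w - p) ≤ 0) (R : ℝ) {ε : ℝ} (hε : 0 < ε) :
    ∃ δ > 0, ∀ v ∈ sublevel h g (h p + r + δ), ‖v - p‖ ≤ R → inner ℝ (u - p) (v - p) ≤ ε := by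
  by_contra! hcon
  have hhalf : Convex ℝ {v : H | ε ≤ inner ℝ (u - p) (v - p)} := by
    intro v hv w hw a b ha hb hab
    have hv' : ε ≤ inner ℝ (u - p) (v - p) := hv
    have hw' : ε ≤ inner ℝ (u - p) (w - p) := hw
    show ε ≤ inner ℝ (u - p) (a • v + b • w - p)
    have e : a • v + b • w - p = a • (v - p) + b • (w - p) := by
      obtain rfl : b = 1 - a := by linarith
      module
    rw [e, inner_add_right, inner_smul_right, inner_smul_right]
    nlinarith
  obtain ⟨q, hq⟩ := nonempty_iInter_of_antitone_convex
    (C := fun n : ℕ => sublevel h g (h p + r + 1 / ((n : ℝ) + 1)) ∩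
      (Metric.closedBall p R ∩ {v : H | ε ≤ inner ℝ (u - p) (v - p)}))
    (fun i j hij => Set.inter_subset_inter_left _ (sublevel_mono (by
      have := Nat.one_div_le_one_div (α := ℝ) hij; linarith)))
    (fun n => by
      obtain ⟨v, hv, hvR, hvε⟩ := hcon _ (Nat.one_div_pos_of_nat (α := ℝ) (n := n))
      exact ⟨v, hv, mem_closedBall_iff_norm.2 hvR, hvε.le⟩)
    (fun n => (isClosed_sublevel hcont hgl _).inter (Metric.isClosed_closedBall.inter
      (isClosed_le continuous_const (by fun_prop))))
    (fun n => (convex_sublevel hc hg hgc _).inter ((convex_closedBall p R).inter hhalf))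
    (R := ‖p‖ + R) (fun v hv => by
      have h1 := mem_closedBall_iff_norm.1 hv.2.1
      have h2 : ‖v‖ ≤ ‖p‖ + ‖v - p‖ := by simpa using norm_add_le p (v - p)
      linarith)
  rw [Set.mem_iInter] at hq
  have hqmin : q ∈ minimizers h g := by
    rw [minimizers_eq_sublevel hg hp hr]
    obtain ⟨s, hs, -⟩ := hg.exists_coe_of_le (hq 0).1
    show g q ≤ _
    rw [hs, EReal.coe_le_coe_iff]
    refine le_of_forall_pos_le_add fun τ hτ => ?_
    obtain ⟨n, hn⟩ := exists_nat_one_div_lt hτ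
    have := (hq n).1
    rw [sublevel, Set.mem_ofPred_eq, hs, EReal.coe_le_coe_iff] at this
    linarith
  have h1 : ε ≤ inner ℝ (u - p) (q - p) := (hq 0).2.2
  linarith [hu q hqmin]

/-! ### A recursive inequality for real sequences -/

theorem tendsto_zero_of_le_one_sub_mul {w t : ℕ → ℝ} {N : ℕ} (hw : ∀ n ≥ N, 0 ≤ w n)
    (hrec : ∀ n ≥ N, w (n + 1) ≤ (1 - t n) * w n)
    (hsum : Tendsto (fun n => ∑ i ∈ Finset.range n, t i) atTop atTop) :
    Tendsto w atTop (𝓝 0) := by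
  have key : ∀ n ≥ N, w n ≤
      w N * Real.exp (∑ i ∈ Finset.range N, t i) * Real.exp (-∑ i ∈ Finset.range n, t i) := by
    intro n hn
    induction n, hn using Nat.le_induction with
    | base => rw [mul_assoc, ← Real.exp_add, add_neg_cancel, Real.exp_zero, mul_one]
    | succ n hn ih =>
      have h1 : 1 - t n ≤ Real.exp (-t n) := by linarith [Real.add_one_le_exp (-t n)]
      rw [Finset.sum_range_succ, neg_add, Real.exp_add, ← mul_assoc]
      calc w (n + 1) ≤ (1 - t n) * w n := hrec n hn
        _ ≤ Real.exp (-t n) * w n := mul_le_mul_of_nonneg_right h1 (hw n hn)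
        _ ≤ _ := by
          rw [mul_comm]
          exact mul_le_mul_of_nonneg_right ih (Real.exp_pos _).le
  have hlim : Tendsto (fun n => w N * Real.exp (∑ i ∈ Finset.range N, t i) *
      Real.exp (-∑ i ∈ Finset.range n, t i)) atTop (𝓝 0) := by
    simpa using (Real.tendsto_exp_neg_atTop_nhds_zero.comp hsum).const_mul
      (w N * Real.exp (∑ i ∈ Finset.range N, t i))
  refine squeeze_zero' ?_ ?_ hlim
  · filter_upwards [eventually_ge_atTop N] with n hn using hw n hn
  · filter_upwards [eventually_ge_atTop N] with n hn using key n hn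

/-- If `s (n + 1) ≤ (1 - κ γ n) s n - d n + γ n c n`, where the perturbation `c n` is bounded above
and is small whenever the gain `d n` is, then `s` tends to zero. For small `γ n`, a gain that is
not small outweighs the bounded perturbation, so that no case distinction on the monotonicity of
`s` is needed. -/
theorem tendsto_zero_of_recursive_le {s d c γ : ℕ → ℝ} {κ B : ℝ} (hκ : 0 < κ)
    (hs : ∀ n, 0 ≤ s n) (hγ : ∀ᶠ n in atTop, 0 ≤ γ n) (hγ0 : Tendsto γ atTop (𝓝 0))
    (hsum : Tendsto (fun n => ∑ i ∈ Finset.range n, γ i) atTop atTop)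
    (hd : ∀ᶠ n in atTop, 0 ≤ d n) (hcB : ∀ᶠ n in atTop, c n ≤ B)
    (hrec : ∀ᶠ n in atTop, s (n + 1) ≤ (1 - κ * γ n) * s n - d n + γ n * c n)
    (hdc : ∀ ε > 0, ∃ δ > 0, ∀ᶠ n in atTop, d n ≤ δ → c n ≤ ε) :
    Tendsto s atTop (𝓝 0) := by
  rw [Metric.tendsto_atTop']
  intro ε hε
  obtain ⟨δ, hδ, hdc⟩ := hdc (κ * (ε / 2)) (by positivity)
  have hsmall : ∀ᶠ n in atTop, γ n * B < δ := by
    have : Tendsto (fun n => γ n * B) atTop (𝓝 0) := by simpa using hγ0.mul_const B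
    exact this.eventually_lt_const hδ
  have hsmall' : ∀ᶠ n in atTop, κ * γ n < 1 := by
    have : Tendsto (fun n => κ * γ n) atTop (𝓝 0) := by simpa using hγ0.const_mul κ
    exact this.eventually_lt_const one_pos
  have hstep : ∀ᶠ n in atTop,
      max (s (n + 1) - ε / 2) 0 ≤ (1 - κ * γ n) * max (s n - ε / 2) 0 := by
    filter_upwards [hγ, hd, hcB, hrec, hdc, hsmall, hsmall'] with n h1 h2 h3 h4 h5 h6 h7
    have h8 : s (n + 1) ≤ (1 - κ * γ n) * s n + κ * γ n * (ε / 2) := by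
      rcases le_or_gt (d n) δ with hle | hgt
      · have := mul_le_mul_of_nonneg_left (h5 hle) h1
        linarith
      · have := mul_le_mul_of_nonneg_left h3 h1
        have : 0 ≤ κ * γ n * (ε / 2) := by positivity
        linarith
    have h9 : 0 ≤ 1 - κ * γ n := by linarith
    have h10 := mul_le_mul_of_nonneg_left (le_max_left (s n - ε / 2) 0) h9
    refine max_le ?_ (mul_nonneg h9 (le_max_right _ _))
    linarith
  obtain ⟨N, hN⟩ := eventually_atTop.1 hstep
  have hsum' : Tendsto (fun n => ∑ i ∈ Finset.range n, κ * γ i) atTop atTop := by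
    simpa only [Finset.mul_sum] using hsum.const_mul_atTop hκ
  have hlim := tendsto_zero_of_le_one_sub_mul (w := fun n => max (s n - ε / 2) 0)
    (fun n _ => le_max_right _ _) hN hsum'
  obtain ⟨M, hM⟩ := eventually_atTop.1 (hlim.eventually_lt_const (half_pos hε))
  refine ⟨M, fun n hn => ?_⟩
  have := (le_max_left (s n - ε / 2) 0).trans_lt (hM n hn.le)
  rw [Real.dist_eq, sub_zero, abs_of_nonneg (hs n)]
  linarith

/-! ### Estimates for one step of the algorithm -/

theorem norm_convex_comb_sub_le {t : ℝ} (h0 : 0 ≤ t) (h1 : t ≤ 1) (u w p : H) :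
    ‖(1 - t) • u + t • w - p‖ ≤ (1 - t) * ‖u - p‖ + t * ‖w - p‖ := by
  have e : (1 - t) • u + t • w - p = (1 - t) • (u - p) + t • (w - p) := by module
  rw [e]
  refine (norm_add_le _ _).trans_eq ?_
  rw [norm_smul, norm_smul, Real.norm_of_nonneg (sub_nonneg.2 h1), Real.norm_of_nonneg h0]

theorem norm_inertialParam_smul_le {θ c : ℝ} (hθ : 0 ≤ θ) (hc : 0 ≤ c) (v w : H) :
    ‖inertialParam θ c v w • (v - w)‖ ≤ c := by
  unfold inertialParam
  split_ifs with h
  · have hpos : 0 < ‖v - w‖ := norm_pos_iff.2 (sub_ne_zero.2 h)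
    rw [norm_smul, Real.norm_of_nonneg (le_min hθ (by positivity))]
    calc min θ (c / ‖v - w‖) * ‖v - w‖ ≤ c / ‖v - w‖ * ‖v - w‖ :=
          mul_le_mul_of_nonneg_right (min_le_right _ _) hpos.le
      _ = c := div_mul_cancel₀ _ hpos.ne'
  · rw [not_not.1 h, sub_self, smul_zero, norm_zero]
    exact hc

/-- The three inner steps of the algorithm, for any map `T` that does not increase the distance to
`p`. -/
theorem norm_inner_steps_sub_le {T : H → H} {p : H} (hT : ∀ u, ‖T u - p‖ ≤ ‖u - p‖)
    {θ c a b : ℝ} (hθ : 0 ≤ θ) (hc : 0 ≤ c) (ha : a ∈ Set.Ioo (0 : ℝ) 1)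
    (hb : b ∈ Set.Ioo (0 : ℝ) 1) {x x' z y ω : H} (hz : z = x + inertialParam θ c x x' • (x - x'))
    (hy : y = (1 - b) • z + b • T z) (hω : ω = T ((1 - a) • T x + a • T y)) :
    ‖ω - p‖ ≤ ‖x - p‖ + c := by
  have h1 : ‖z - p‖ ≤ ‖x - p‖ + c := by
    have e : z - p = (x - p) + inertialParam θ c x x' • (x - x') := by rw [hz]; abel
    rw [e]
    exact (norm_add_le _ _).trans (add_le_add_right (norm_inertialParam_smul_le hθ hc x x') _)
  have h2 : ‖y - p‖ ≤ ‖z - p‖ := by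
    rw [hy]
    refine (norm_convex_comb_sub_le hb.1.le hb.2.le _ _ _).trans ?_
    have := mul_le_mul_of_nonneg_left (hT z) hb.1.le
    linarith
  have h3 : ‖ω - p‖ ≤ (1 - a) * ‖x - p‖ + a * ‖y - p‖ := by
    rw [hω]
    refine (hT _).trans ((norm_convex_comb_sub_le ha.1.le ha.2.le _ _ _).trans ?_)
    exact add_le_add (mul_le_mul_of_nonneg_left (hT x) (sub_nonneg.2 ha.2.le))
      (mul_le_mul_of_nonneg_left (hT y) ha.1.le)
  have h4 := mul_le_mul_of_nonneg_left (h2.trans h1) ha.1.le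
  have h5 := mul_le_of_le_one_left hc ha.2.le
  linarith

theorem norm_contraction_step_sub_le {f : H → H} {k : NNReal} (hf : LipschitzWith k f) {t : ℝ}
    (ht : t ∈ Set.Ioo (0 : ℝ) 1) {v ω p : H} (hv : ‖v - p‖ ≤ ‖ω - p‖) :
    ‖(1 - t) • v + t • f ω - p‖ ≤ (1 - (1 - k) * t) * ‖ω - p‖ + t * ‖f p - p‖ := by
  have h1 : ‖f ω - p‖ ≤ k * ‖ω - p‖ + ‖f p - p‖ :=
    (norm_sub_le_norm_sub_add_norm_sub _ (f p) _).trans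
      (add_le_add_left (hf.norm_sub_le ω p) _)
  have h2 := norm_convex_comb_sub_le ht.1.le ht.2.le v (f ω) p
  have h3 := mul_le_mul_of_nonneg_left hv (sub_nonneg.2 ht.2.le)
  have h4 := mul_le_mul_of_nonneg_left h1 ht.1.le
  linarith

theorem norm_contraction_step_sub_sq_le {f : H → H} {k : NNReal} (hf : ContractingWith k f)
    {t : ℝ} (ht : t ∈ Set.Ioo (0 : ℝ) 1) {v ω p x : H} (hx : x = (1 - t) • v + t • f ω) :
    ‖x - p‖ ^ 2 ≤ (1 - (1 - k) * t) * ‖ω - p‖ ^ 2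
      - (1 - t) * (‖ω - p‖ ^ 2 - ‖v - p‖ ^ 2) + t * (2 * inner ℝ (f p - p) (x - p)) := by
  set b := f p - p
  set w := (1 - t) • v + t • (f ω - b) - p with hw
  have e : x - p = w + t • b := by rw [hx, hw]; module
  have h1 : ‖x - p‖ ^ 2 ≤ ‖w‖ ^ 2 + t * (2 * inner ℝ b (x - p)) := by
    have h2 := norm_sub_sq_real (x - p) (t • b)
    rw [e, add_sub_cancel_right, ← e, inner_smul_right, real_inner_comm] at h2
    nlinarith [sq_nonneg ‖t • b‖]
  have hk : (k : ℝ) ≤ 1 := by exact_mod_cast hf.1.le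
  have hk0 : (0 : ℝ) ≤ k := k.2
  have hfb : ‖f ω - b - p‖ ≤ k * ‖ω - p‖ := by
    have e' : f ω - b - p = f ω - f p := by simp only [b]; abel
    rw [e']
    exact hf.2.norm_sub_le ω p
  have h3 : ‖w‖ ≤ (1 - t) * ‖v - p‖ + t * (k * ‖ω - p‖) :=
    (norm_convex_comb_sub_le ht.1.le ht.2.le _ _ _).trans
      (add_le_add_right (mul_le_mul_of_nonneg_left hfb ht.1.le) _)
  have h4 := pow_le_pow_left₀ (norm_nonneg _) h3 2
  -- Convexity of the square, followed by `k ^ 2 ≤ k`.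
  have h5 : ((1 - t) * ‖v - p‖ + t * (k * ‖ω - p‖)) ^ 2
      ≤ (1 - t) * ‖v - p‖ ^ 2 + t * (k * ‖ω - p‖) ^ 2 := by
    have : 0 ≤ t * (1 - t) * (‖v - p‖ - k * ‖ω - p‖) ^ 2 :=
      mul_nonneg (mul_nonneg ht.1.le (sub_nonneg.2 ht.2.le)) (sq_nonneg _)
    linarith
  have h6 : t * (k * ‖ω - p‖) ^ 2 ≤ t * (k * ‖ω - p‖ ^ 2) := by
    refine mul_le_mul_of_nonneg_left ?_ ht.1.le
    rw [mul_pow]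
    exact mul_le_mul_of_nonneg_right (pow_le_of_le_one hk0 hk two_ne_zero) (sq_nonneg _)
  linarith

end ProxGrad

/-! ### Convergence of the algorithm -/

theorem mainTheorem3 {H : Type*} [NormedAddCommGroup H] [InnerProductSpace ℝ H] [CompleteSpace H]
    -- the contraction
    (f : H → H) (k : NNReal) (hf : ContractingWith k f)
    -- the two convex functions
    (h : H → ℝ) (h_diff : Differentiable ℝ h) (h_conv : ConvexOn ℝ Set.univ h)
    (η : ℝ) (h_ism : ProxGrad.InverseStronglyMonotone η (gradient h))
    (g : H → EReal) (g_proper : ProxGrad.IsProper g) (g_conv : ProxGrad.IsConvex g)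
    (g_lsc : LowerSemicontinuous g)
    (h_min : (ProxGrad.minimizers h g).Nonempty)
    -- the parameters, where `e` is the sequence that tends to zero in the inertial term
    (lam : ℕ → ℝ) (lam' : ℝ) (θ : ℝ) (e α β γ : ℕ → ℝ) (a a' : ℝ)
    (h_lam : ∀ n ≥ 1, lam n ∈ Set.Ioo 0 (2 * η)) (h_lam' : lam' ∈ Set.Ioo 0 (2 * η))
    (h_lam_lim : Tendsto lam atTop (𝓝 lam'))
    (hθ : 0 ≤ θ)
    (he : ∀ n ≥ 1, 0 < e n)
    (hα : ∀ n ≥ 1, α n ∈ Set.Ioo (0 : ℝ) 1)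
    (hβ : ∀ n ≥ 1, β n ∈ Set.Ioo (0 : ℝ) 1)
    (hγ : ∀ n ≥ 1, γ n ∈ Set.Ioo (0 : ℝ) 1)
    (ha : 0 < a) (ha' : a' < 1) (hα_bd : ∀ n ≥ 1, a ≤ α n ∧ α n < a')
    (he_lim : Tendsto e atTop (𝓝 0))
    (hγ_lim : Tendsto γ atTop (𝓝 0))
    (hγ_sum : Tendsto (fun N => ∑ n ∈ Finset.Icc 1 N, γ n) atTop atTop)
    -- the algorithm, started at arbitrary points `x 0` and `x 1`
    (x z y ω : ℕ → H)
    (hz : ∀ n ≥ 1, z n = x n +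
      ProxGrad.inertialParam θ (e n * γ n) (x n) (x (n - 1)) • (x n - x (n - 1)))
    (hy : ∀ n ≥ 1, y n = (1 - β n) • z n + β n • ProxGrad.proxGradMap h g (lam n) (z n))
    (hω : ∀ n ≥ 1, ω n = ProxGrad.proxGradMap h g (lam n)
      ((1 - α n) • ProxGrad.proxGradMap h g (lam n) (x n) +
        α n • ProxGrad.proxGradMap h g (lam n) (y n)))
    (hx : ∀ n ≥ 1, x (n + 1) =
      (1 - γ n) • ProxGrad.proxGradMap h g (lam n) (ω n) + γ n • f (ω n)) :
    ∃ xstar ∈ ProxGrad.minimizers h g,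
      ProxGrad.IsMetricProjection (ProxGrad.minimizers h g) (f xstar) xstar ∧
        Tendsto x atTop (𝓝 xstar) := by
  have hcont := h_diff.continuous
  obtain ⟨p, hp, r, hr, hvi⟩ : ∃ p ∈ ProxGrad.minimizers h g, ∃ r : ℝ, g p = r ∧
      ∀ w ∈ ProxGrad.minimizers h g, inner ℝ (f p - p) (w - p) ≤ 0 := by
    obtain ⟨q, hq⟩ := h_min
    obtain ⟨s, hs, -⟩ := (ProxGrad.mem_minimizers_iff g_proper).1 hq
    have hset := ProxGrad.minimizers_eq_sublevel g_proper hq hs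
    obtain ⟨p, hp, hvi⟩ := ProxGrad.exists_fixedPoint_projection ⟨q, hq⟩
      (hset ▸ ProxGrad.isClosed_sublevel hcont g_lsc _)
      (hset ▸ ProxGrad.convex_sublevel h_conv g_proper g_conv _) hf
    obtain ⟨r, hr, -⟩ := (ProxGrad.mem_minimizers_iff g_proper).1 hp
    exact ⟨p, hp, r, hr, hvi⟩
  refine ⟨p, hp, ProxGrad.isMetricProjection_of_inner_le_zero hp hvi, ?_⟩
  have hη : 0 < η := h_ism.1
  have hκ : (0 : ℝ) < 1 - k := sub_pos.2 (by exact_mod_cast hf.1)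
  have hk0 : (0 : ℝ) ≤ k := k.2
  have hT : ∀ n ≥ 1, ∀ u, ‖ProxGrad.proxGradMap h g (lam n) u - p‖ ≤ ‖u - p‖ := fun n hn =>
    ProxGrad.norm_proxGradMap_sub_le h_diff h_ism g_proper g_conv g_lsc (h_lam n hn) hp
  set v : ℕ → H := fun n => ProxGrad.proxGradMap h g (lam n) (ω n) with hv
  have hvω : ∀ n ≥ 1, ‖v n - p‖ ≤ ‖ω n - p‖ := fun n hn => hT n hn _
  have hωx : ∀ n ≥ 1, ‖ω n - p‖ ≤ ‖x n - p‖ + e n * γ n := fun n hn =>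
    ProxGrad.norm_inner_steps_sub_le (hT n hn) hθ (mul_pos (he n hn) (hγ n hn).1).le (hα n hn)
      (hβ n hn) (hz n hn) (hy n hn) (hω n hn)
  obtain ⟨E, hE⟩ : ∃ E, ∀ n, e n ≤ E := by
    obtain ⟨E, hE⟩ := he_lim.bddAbove_range
    exact ⟨E, fun n => hE ⟨n, rfl⟩⟩
  have hE0 : 0 < E := (he 1 le_rfl).trans_le (hE 1)
  have heγ : ∀ n ≥ 1, e n * γ n ≤ E := fun n hn =>
    (mul_le_of_le_one_right (he n hn).le (hγ n hn).2.le).trans (hE n)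
  -- The iterates stay in a ball around `p`.
  obtain ⟨R, hR⟩ : ∃ R, ∀ n ≥ 1, ‖x n - p‖ ≤ R := by
    refine ⟨max ‖x 1 - p‖ ((E + ‖f p - p‖) / (1 - k)), fun n hn => ?_⟩
    set R := max ‖x 1 - p‖ ((E + ‖f p - p‖) / (1 - k))
    induction n, hn using Nat.le_induction with
    | base => exact le_max_left _ _
    | succ n hn ih =>
      have h1 := ProxGrad.norm_contraction_step_sub_le hf.2 (hγ n hn) (hvω n hn)
      rw [← hx n hn] at h1
      have hγn := hγ n hn
      have h2 : (E + ‖f p - p‖) ≤ (1 - k) * R := by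
        rw [mul_comm, ← div_le_iff₀ hκ]; exact le_max_right _ _
      have h3 : (1 - k) * γ n ≤ 1 := by nlinarith [hγn.1, hγn.2]
      have h4 := mul_le_mul_of_nonneg_left ((hωx n hn).trans (add_le_add_left ih _))
        (sub_nonneg.2 h3)
      have h5 : 0 ≤ (1 - k) * γ n * (e n * γ n) :=
        mul_nonneg (mul_pos hκ hγn.1).le (mul_pos (he n hn) hγn.1).le
      have h6 := mul_le_mul_of_nonneg_left (add_le_add_left (hE n) ‖f p - p‖) hγn.1.le
      have h7 := mul_le_mul_of_nonneg_left h2 hγn.1.le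
      linarith
  have hR0 : 0 ≤ R := (norm_nonneg _).trans (hR 1 le_rfl)
  have hωR : ∀ n ≥ 1, ‖ω n - p‖ ≤ R + E := fun n hn =>
    (hωx n hn).trans (add_le_add (hR n hn) (heγ n hn))
  have hvR : ∀ n ≥ 1, ‖v n - p‖ ≤ R + E := fun n hn => (hvω n hn).trans (hωR n hn)
  have hge := eventually_ge_atTop (α := ℕ) 1
  suffices hs : Tendsto (fun n => ‖x n - p‖ ^ 2) atTop (𝓝 0) by
    have := hs.sqrt
    simp only [Real.sqrt_sq (norm_nonneg _), Real.sqrt_zero] at this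
    exact tendsto_iff_norm_sub_tendsto_zero.2 this
  refine ProxGrad.tendsto_zero_of_recursive_le (γ := γ)
    (d := fun n => (1 - γ n) * (‖ω n - p‖ ^ 2 - ‖v n - p‖ ^ 2))
    (c := fun n => e n * (2 * R + E) + 2 * inner ℝ (f p - p) (x (n + 1) - p))
    (B := E * (2 * R + E) + 2 * (‖f p - p‖ * R)) hκ (fun n => sq_nonneg _) ?_ hγ_lim ?_ ?_ ?_ ?_ ?_
  · filter_upwards [hge] with n hn using (hγ n hn).1.le
  · -- Summation from `0` instead of `1` adds only the constant `γ 0`.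
    rw [← tendsto_add_atTop_iff_nat 1]
    refine (tendsto_atTop_add_const_left _ (γ 0) hγ_sum).congr fun N => ?_
    rw [Finset.range_eq_Ico, Finset.sum_eq_sum_Ico_succ_bot N.succ_pos]
    rfl
  · filter_upwards [hge] with n hn
    exact mul_nonneg (sub_nonneg.2 (hγ n hn).2.le)
      (sub_nonneg.2 (pow_le_pow_left₀ (norm_nonneg _) (hvω n hn) 2))
  · filter_upwards [hge] with n hn
    have h1 := real_inner_le_norm (f p - p) (x (n + 1) - p)
    have h2 := mul_le_mul_of_nonneg_left (hR (n + 1) (by omega)) (norm_nonneg (f p - p))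
    have h3 := mul_le_mul_of_nonneg_right (hE n) (by positivity : 0 ≤ 2 * R + E)
    linarith
  · filter_upwards [hge] with n hn
    have hγn := hγ n hn
    have h1 := ProxGrad.norm_contraction_step_sub_sq_le hf hγn (p := p) (hx n hn)
    have h2 := pow_le_pow_left₀ (norm_nonneg _) (hωx n hn) 2
    have h3 : (‖x n - p‖ + e n * γ n) ^ 2 ≤ ‖x n - p‖ ^ 2 + γ n * (e n * (2 * R + E)) := by
      have h4 := mul_le_mul_of_nonneg_left
        (add_le_add (mul_le_mul_of_nonneg_left (hR n hn) zero_le_two) (heγ n hn))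
        (mul_pos (he n hn) hγn.1).le
      linarith
    have h5 : 0 ≤ 1 - (1 - k) * γ n := by nlinarith [hγn.1, hγn.2]
    have h6 := mul_le_mul_of_nonneg_left (h2.trans h3) h5
    have h7 : 0 ≤ (1 - k) * γ n * (γ n * (e n * (2 * R + E))) :=
      mul_nonneg (mul_pos hκ hγn.1).le
        (mul_nonneg hγn.1.le (mul_nonneg (he n hn).le (by positivity)))
    linarith
  · intro ε hε
    obtain ⟨δ, hδ, hδv⟩ := ProxGrad.exists_sublevel_inner_le hcont h_conv g_proper g_conv g_lsc
      hp hr hvi (R + E) (show 0 < ε / 8 by positivity)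
    have hlam0 := h_lam'.1
    have hc0 : 0 < (2 * η - lam') / 2 := half_pos (sub_pos.2 h_lam'.2)
    set c₀ := (2 * η - lam') / 2 with hc₀
    set M := ((lam' / 2)⁻¹ + η⁻¹) * (R + E) with hM
    have hM0 : 0 < M := by positivity
    -- If the gain is at most the bound below, then `ω n` moves by at most `δ / M`, so that `v n`
    -- lies in the `δ`-sublevel set.
    refine ⟨(δ / M) ^ 2 * c₀ / (4 * η), by positivity, ?_⟩
    have hlim1 : Tendsto (fun n => e n * (2 * R + E)) atTop (𝓝 0) := by
      simpa using he_lim.mul_const (2 * R + E)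
    set K := k * (R + E) + ‖f p - p‖ + (R + E) with hK
    have hlim2 : Tendsto (fun n => 2 * (‖f p - p‖ * (γ n * K))) atTop (𝓝 0) := by
      simpa using ((hγ_lim.mul_const K).const_mul ‖f p - p‖).const_mul 2
    filter_upwards [hge, hlim1.eventually_lt_const (show 0 < ε / 4 by positivity),
      hlim2.eventually_lt_const (show 0 < ε / 4 by positivity),
      hγ_lim.eventually_lt_const (half_pos one_pos),
      h_lam_lim.eventually_const_lt (half_lt_self hlam0),
      h_lam_lim.eventually_lt_const (show lam' < 2 * η - c₀ by linarith)]
      with n hn hn1 hn2 hn3 hn4 hn5 hgain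
    have hγn := hγ n hn
    have hmove : ‖ω n - v n‖ ≤ δ / M := by
      have h1 := ProxGrad.norm_sub_proxGradMap_sq_le h_diff h_ism g_proper g_conv g_lsc
        (h_lam n hn).1 hp (ω n)
      change (2 * η - lam n) * ‖ω n - v n‖ ^ 2 ≤ 2 * η * (‖ω n - p‖ ^ 2 - ‖v n - p‖ ^ 2) at h1
      have h2 : 0 ≤ ‖ω n - p‖ ^ 2 - ‖v n - p‖ ^ 2 :=
        sub_nonneg.2 (pow_le_pow_left₀ (norm_nonneg _) (hvω n hn) 2)
      have h3 : c₀ * ‖ω n - v n‖ ^ 2 ≤ (2 * η - lam n) * ‖ω n - v n‖ ^ 2 :=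
        mul_le_mul_of_nonneg_right (by linarith) (sq_nonneg _)
      have h4 : (‖ω n - p‖ ^ 2 - ‖v n - p‖ ^ 2) / 2 ≤ (δ / M) ^ 2 * c₀ / (4 * η) := by
        refine le_trans ?_ hgain
        nlinarith
      rw [le_div_iff₀ (by positivity)] at h4
      have h5 : c₀ * ‖ω n - v n‖ ^ 2 ≤ c₀ * (δ / M) ^ 2 := by linarith
      exact (sq_le_sq₀ (norm_nonneg _) (by positivity)).1 (le_of_mul_le_mul_left h5 hc0)
    have hsub : v n ∈ ProxGrad.sublevel h g (h p + r + δ) := by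
      refine ProxGrad.sublevel_mono ?_ (ProxGrad.proxGradMap_mem_sublevel h_diff h_conv h_ism
        g_proper g_conv g_lsc (h_lam n hn).1 hr (ω n))
      have h1 : ((lam n)⁻¹ + η⁻¹) * ‖ω n - v n‖ * ‖v n - p‖ ≤
          ((lam' / 2)⁻¹ + η⁻¹) * (δ / M) * (R + E) := by
        have := hvR n hn
        have := hn4.le
        gcongr
      have h2 : ((lam' / 2)⁻¹ + η⁻¹) * (δ / M) * (R + E) = δ := by
        rw [mul_right_comm, ← hM, mul_div_cancel₀ _ hM0.ne']
      exact add_le_add_right (h1.trans_eq h2) _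
    have hin := hδv (v n) hsub (hvR n hn)
    have hxv : ‖x (n + 1) - v n‖ ≤ γ n * K := by
      have e1 : x (n + 1) - v n = γ n • (f (ω n) - v n) := by rw [hx n hn]; module
      rw [e1, norm_smul, Real.norm_of_nonneg hγn.1.le]
      refine mul_le_mul_of_nonneg_left ?_ hγn.1.le
      have h1 := norm_sub_le_norm_sub_add_norm_sub (f (ω n)) (f p) (v n)
      have h2 := norm_sub_le_norm_sub_add_norm_sub (f p) p (v n)
      have h3 := (hf.2.norm_sub_le (ω n) p).trans (mul_le_mul_of_nonneg_left (hωR n hn) hk0)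
      have h4 := hvR n hn
      rw [norm_sub_rev] at h4
      linarith
    have h1 : inner ℝ (f p - p) (x (n + 1) - p) =
        inner ℝ (f p - p) (v n - p) + inner ℝ (f p - p) (x (n + 1) - v n) := by
      rw [← inner_add_right]; congr 1; abel
    have h2 := (real_inner_le_norm (f p - p) (x (n + 1) - v n)).trans
      (mul_le_mul_of_nonneg_left hxv (norm_nonneg _))
    linarith
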